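/- **Definitions.** A *Dyck word* of even length $N$ is a word $\sigma\in\{+1,-1\}^N$ with $\sum_{i\le N}\sigma(i)=0$ and $\sum_{i\le k}\sigma(i)\ge 0$ for all $k\le N$. A *re-pairing* of $\sigma$ is a sequence $p=((\ell_1,r_1),\dots,(\ell_{N/2},r_{N/2}))$ such that $\sigma(\ell_i)=+1$, $\sigma(r_i)=-1$, $\ell_i<r_i$ for all $i$, and every number in $\{1,\dots,N\}$ occurs in exactly one pair. Put $B_t(p)=\{\ell_i,r_i : i\le t\}$. The width of a finite set of integers is the smallest number of intervals $[a,b]=\{x\in\mathbb Z: a\le x\le b\}$ whose union is that set; $\operatorname{width}(p)=\max_t \operatorname{width}(B_t(p))$; and $\operatorname{width}(\sigma)$ is the minimum of $\operatorname{width}(p)$ over all re-pairings $p$ of $\sigma$. For even $n\ge 2$, the *universal one-counter set* $U_n$, over the alphabet $\{c_{ij}:0\le i<j<n\}\cup\{a_i:0\le i<n\}$, is the set of vectors $(y_{ij},x_i)$ of nonnegative integers (indexed by the letters $c_{ij}$ and $a_i$) such that 1. $y_{ij}\in\{0,1\}$ and the directed graph on $\{0,\dots,n-1\}$ with edge set $\{(i,j):y_{ij}=1\}$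 is a monotone path from $0$ to $n-1$; 2. $\sum_{i=0}^{n-1}(-1)^i x_i=0$ and $\sum_{i=0}^{k}(-1)^i x_i\ge 0$ for $0\le k<n-1$; 3. if $x_j>0$ and $j>0$, then $y_{ij}=1$ for some $i$; if $x_j>0$ and $j<n-1$, then $y_{jk}=1$ for some $k$. The *Parikh image* of a language is the set of vectors of letter counts of its words. **Theorem.** For every constant $C>0$ there is a constant $c>0$ such that the following holds for every even $n\ge 2$. Let $\sigma$ be any Dyck word of length at most $C\sqrt n$, and let $\mathcal A$ be a nondeterministic finite automaton recognizing a language whose Parikh image is $U_n$. Then $\mathcal A$ has at least $n^{c\cdot\operatorname{width}(\sigma)}$ states. (That is, if $\sigma_n$ has length $O(\sqrt n)$, then the number of states is $n^{\Omega(\operatorname{width}(\sigma_n))}$.) -/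

import Mathlib

/-- The width of a set of positions: the smallest number of intervals `[a, b]` whose union is the
set. It is used for finite sets only (where such a number exists). -/
noncomputable def setWidth (S : Set ℕ) : ℕ :=
  sInf {k : ℕ | ∃ a b : Fin k → ℕ, S = ⋃ i, Set.Icc (a i) (b i)}

/-- A re-pairing of a Dyck word `σ` of length `N`: a sequence of `N / 2` pairs
`(left i, right i)` of positions of `σ` (numbered from `0`), each formed by an opening bracket and
a closing bracket to the right of it, such that every position occurs in exactly one pair. -/
structure RePairing (σ : DyckWord) where
  left : Fin σ.semilength → Fin σ.toList.length
  right : Fin σ.semilength → Fin σ.toList.length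
  get_left : ∀ i, σ.toList.get (left i) = DyckStep.U
  get_right : ∀ i, σ.toList.get (right i) = DyckStep.D
  left_lt_right : ∀ i, left i < right i
  existsUnique_pair : ∀ b : Fin σ.toList.length, ∃! i, left i = b ∨ right i = b

/-- The set of positions erased by the first `t` pairs of a re-pairing. -/
def RePairing.erased {σ : DyckWord} (p : RePairing σ) (t : ℕ) : Set ℕ :=
  {b : ℕ | ∃ i : Fin σ.semilength, (i : ℕ) < t ∧ (b = (p.left i : ℕ) ∨ b = (p.right i : ℕ))}

/-- The width of a re-pairing: the maximum over all times `t ≤ N / 2` of the width of the set of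
positions erased up to time `t`. -/
noncomputable def RePairing.width {σ : DyckWord} (p : RePairing σ) : ℕ :=
  (Finset.range (σ.semilength + 1)).sup fun t => setWidth (p.erased t)

/-- The width of a Dyck word: the minimum of the widths of its re-pairings. -/
noncomputable def DyckWord.width (σ : DyckWord) : ℕ :=
  sInf (Set.range fun p : RePairing σ => p.width)

/-- The alphabet `{c_{ij} : 0 ≤ i < j < n} ∪ {a_i : 0 ≤ i < n}`. -/
inductive OCLetter (n : ℕ) where
  | c (i j : Fin n) (h : i < j) : OCLetter n
  | a (i : Fin n) : OCLetter n
  deriving DecidableEq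

/-- The Parikh image of a language: the set of the vectors of letter counts of its words. -/
def parikhImage {α : Type*} [DecidableEq α] (L : Language α) : Set (α → ℕ) :=
  {v | ∃ w ∈ L, v = fun a => w.count a}

/-- `y` takes values in `{0, 1}`, and the directed graph with edges `{(i, j) : y_{ij} = 1}` is a
monotone path from `0` to `n - 1`; `l` lists the vertices of the path, and its edges are the pairs
of consecutive entries of `l`. -/
def IsChainVector (n : ℕ) (y : (i j : Fin n) → i < j → ℕ) : Prop :=
  (∀ i j h, y i j h = 0 ∨ y i j h = 1) ∧
  ∃ l : List (Fin n), l.IsChain (· < ·) ∧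
    (∃ s ∈ l.head?, (s : ℕ) = 0) ∧ (∃ t ∈ l.getLast?, (t : ℕ) + 1 = n) ∧
    ∀ i j h, y i j h = 1 ↔ (i, j) ∈ l.zip l.tail

/-- `x` is a balanced vector. -/
def IsBalancedVector (n : ℕ) (x : Fin n → ℕ) : Prop :=
  ∑ i : Fin n, (-1 : ℤ) ^ (i : ℕ) * (x i : ℤ) = 0 ∧
  ∀ k : Fin n, (k : ℕ) + 1 < n → 0 ≤ ∑ i ∈ Finset.Iic k, (-1 : ℤ) ^ (i : ℕ) * (x i : ℤ)

/-- `x` is compatible with `y`: every `j` with `x_j > 0` has an incoming edge unless `j = 0`, and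
an outgoing edge unless `j = n - 1`. -/
def IsCompatible (n : ℕ) (y : (i j : Fin n) → i < j → ℕ) (x : Fin n → ℕ) : Prop :=
  ∀ j : Fin n, 0 < x j →
    (0 < (j : ℕ) → ∃ (i : Fin n) (h : i < j), y i j h = 1) ∧
    ((j : ℕ) + 1 < n → ∃ (k : Fin n) (h : j < k), y j k h = 1)

/-- The universal one-counter set `U_n`; the coordinate `y_{ij}` of a vector is its value at the
letter `c_{ij}`, and the coordinate `x_i` is its value at `a_i`. -/
def universalOneCounterSet (n : ℕ) : Set (OCLetter n → ℕ) :=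
  {v | IsChainVector n (fun i j h => v (OCLetter.c i j h)) ∧
    IsBalancedVector n (fun i => v (OCLetter.a i)) ∧
    IsCompatible n (fun i j h => v (OCLetter.c i j h)) (fun i => v (OCLetter.a i))}

/-! The argument places the brackets of `σ` at inner vertices, opening ones at even and closing ones
at odd vertices, takes the monotone path through exactly these vertices, and repeats each letter
`a_i` of the placement `M` times, where `M` is the number of states. The resulting vector lies in
`U_n`, so some accepted word `w` realizes it.

Along an accepting run on `w` every bracket letter must be pumped. Each cycle contains no edge
letter and is balanced by itself (`signedCount_Ici_nonpos_of_pump`). Hall's theorem, fed by the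
bound on run weights `RunIn.weight_lt_ncard`, then matches each opening bracket with a later closing
bracket that shares a cycle with it at some state of the run (`IsPlacement.exists_matching`).
Erasing matched pairs in the order in which these states are visited is a re-pairing of `σ`.

A state `q` forces a vertex if every accepted word with a run through `q` uses that vertex. By
exchanging prefixes and suffixes at `q`, an unforced vertex has both of its path edges on the same
side of `q`, and any cycle through its letter lies on that side too. Hence the boundaries of the
erased set occur only next to forced vertices, and some state forces about `width σ / 2` vertices of
the placement (`IsPlacement.width_le`).

Finally, a state that forces `s` vertices can serve only placements that contain them. Choosing each
bracket's vertex among `b` candidates in its own block gives at least `b ^ s` states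
(`pow_le_card_states`), and `b` about `n ^ (1/4)` fits when the length of `σ` is `O(√n)` and `n` is
large. -/

/-! ### Runs of an automaton -/

/-- `RunIn A S p w q`: the automaton `A` has a run on `w` from `p` to `q` all of whose states lie
in `S`. -/
inductive RunIn {α Q : Type*} (A : NFA α Q) (S : Set Q) : Q → List α → Q → Prop
  | nil {p : Q} : p ∈ S → RunIn A S p [] p
  | cons {p q r : Q} {a : α} {w : List α} :
      p ∈ S → q ∈ A.step p a → RunIn A S q w r → RunIn A S p (a :: w) r

namespace RunIn

variable {α Q : Type*} {A : NFA α Q} {S T : Set Q} {p q r : Q} {u v w : List α}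

theorem left_mem (h : RunIn A S p w q) : p ∈ S := by
  cases h <;> assumption

theorem mono (hST : S ⊆ T) (h : RunIn A S p w q) : RunIn A T p w q := by
  induction h with
  | nil hp => exact .nil (hST hp)
  | cons hp hs _ ih => exact .cons (hST hp) hs ih

theorem append (h₁ : RunIn A S p u q) (h₂ : RunIn A S q v r) : RunIn A S p (u ++ v) r := by
  induction h₁ with
  | nil _ => exact h₂
  | cons hp hs _ ih => exact .cons hp hs (ih h₂)

theorem of_path (h : A.Path p q w) : RunIn A Set.univ p w q := by
  induction h with
  | nil s => exact .nil trivial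
  | cons t s u a x hs _ ih => exact .cons trivial hs ih

theorem nonempty_path (h : RunIn A S p w q) : Nonempty (A.Path p q w) := by
  induction h with
  | nil _ => exact ⟨.nil _⟩
  | cons _ hs _ ih => exact ih.map (.cons _ _ _ _ _ hs)

/-- Splitting a run at its last visit to the state `s`. -/
theorem last_visit (s : Q) (h : RunIn A S p w q) :
    RunIn A (S \ {s}) p w q ∨ ∃ y z, w = y ++ z ∧ RunIn A S p y s ∧
      (z = [] ∨ ∃ a z' t, z = a :: z' ∧ RunIn A (S \ {s}) t z' q) := by
  induction h with
  | @nil p hp =>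
    by_cases hps : p = s
    · subst hps
      exact .inr ⟨[], [], rfl, .nil hp, .inl rfl⟩
    · exact .inl (.nil ⟨hp, hps⟩)
  | @cons p t r a w hp hs hr ih =>
    rcases ih with ih | ⟨y, z, rfl, hy, hz⟩
    · by_cases hps : p = s
      · subst hps
        exact .inr ⟨[], a :: w, rfl, .nil hp, .inr ⟨a, w, t, rfl, ih⟩⟩
      · exact .inl (.cons ⟨hp, hps⟩ hs ih)
    · exact .inr ⟨a :: y, z, rfl, .cons hp hs hy, hz⟩

/-- If every letter has weight at most one and every cycle has nonpositive weight, then the weight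
of a run is less than its number of states. -/
theorem weight_lt_ncard [Finite Q] (g : α → ℤ) (hg : ∀ a, g a ≤ 1) (L : Set α) :
    ∀ (k : ℕ) (S : Set Q), S.ncard = k →
      (∀ s ∈ S, ∀ y, RunIn A S s y s → (∀ a ∈ y, a ∈ L) → (y.map g).sum ≤ 0) →
      ∀ p w q, RunIn A S p w q → (∀ a ∈ w, a ∈ L) → (w.map g).sum < k := by
  intro k
  induction k with
  | zero =>
    intro S hS _ p w q h
    rw [Set.ncard_eq_zero] at hS
    exact absurd h.left_mem (by simp [hS])
  | succ k ih =>
    intro S hS hc p w q h hL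
    have hp := h.left_mem
    -- The run up to its last visit to `p` is a cycle of nonpositive weight. One letter of weight at
    -- most one leaves `p`, and the remainder avoids `p`, so the induction applies to it.
    rcases h.last_visit p with h | ⟨y, z, rfl, hy, hz⟩
    · exact absurd h.left_mem (by simp)
    · have hy0 := hc p hp y hy fun a ha => hL a (by simp [ha])
      rcases hz with rfl | ⟨a, z', t, rfl, hz⟩
      · simp only [List.append_nil]
        push_cast
        omega
      · have := ih (S \ {p}) (by rw [Set.ncard_sdiff_singleton_of_mem hp]; omega)
          (fun s hs x hx => hc s hs.1 x (hx.mono Set.sdiff_subset)) t z' q hz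
          fun b hb => hL b (by simp [hb])
        have := hg a
        simp only [List.map_append, List.sum_append, List.map_cons, List.sum_cons]
        push_cast
        omega

/-- The states of a run, indexed by time. -/
theorem exists_states (h : RunIn A S p w q) :
    ∃ st : ℕ → Q, st 0 = p ∧ st w.length = q ∧
      ∀ T : Set Q, (∀ i ≤ w.length, st i ∈ T) →
        ∀ i j, i ≤ j → j ≤ w.length → RunIn A T (st i) ((w.take j).drop i) (st j) := by
  induction h with
  | @nil p hp =>
    refine ⟨fun _ => p, rfl, rfl, fun T hT i j _ _ => ?_⟩
    simpa using RunIn.nil (hT 0 le_rfl)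
  | @cons p t r a w hp hs hr ih =>
    obtain ⟨st, h0, h1, h⟩ := ih
    refine ⟨fun i => Nat.casesOn i p st, rfl, h1, fun T hT i j hij hj => ?_⟩
    have hT' : ∀ i ≤ w.length, st i ∈ T := fun i hi => hT (i + 1) (by simpa using hi)
    rcases i with _ | i <;> rcases j with _ | j
    · exact .nil (hT 0 (by simp))
    · have := h T hT' 0 j (by simp) (by simpa using hj)
      rw [h0] at this
      exact .cons (hT 0 (by simp)) hs this
    · omega
    · exact h T hT' i j (by omega) (by simpa using hj)

end RunIn

theorem mem_accepts_iff_runIn {α Q : Type*} {A : NFA α Q} {w : List α} :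
    w ∈ A.accepts ↔ ∃ s ∈ A.start, ∃ f ∈ A.accept, RunIn A Set.univ s w f := by
  rw [NFA.accepts_iff_exists_path]
  constructor
  · rintro ⟨s, hs, f, hf, ⟨p⟩⟩
    exact ⟨s, hs, f, hf, .of_path p⟩
  · rintro ⟨s, hs, f, hf, h⟩
    exact ⟨s, hs, f, hf, h.nonempty_path⟩

/-! ### The width of a set of positions -/

/-- From each point of `D` in `S`, extend to the right as long as possible inside `S`. Every maximal
interval is obtained from its left end; further points of `D` only add overlapping intervals, which
the definition of width allows. -/
theorem setWidth_le_card_starts {N : ℕ} {S : Set ℕ} (hS : ∀ x ∈ S, x < N) (D : Finset ℕ)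
    (hD : ∀ x ∈ S, (x = 0 ∨ x - 1 ∉ S) → x ∈ D) : setWidth S ≤ D.card := by
  classical
  set E := D.filter (· ∈ S) with hE
  have hED : E.card ≤ D.card := Finset.card_filter_le _ _
  refine le_trans (Nat.sInf_le ?_) hED
  let e := E.equivFin.symm
  refine ⟨fun i => (e i : ℕ), fun i => Nat.findGreatest
    (fun m => ∀ y, (e i : ℕ) ≤ y → y ≤ m → y ∈ S) N, ?_⟩
  ext x
  simp only [Set.mem_iUnion, Set.mem_Icc]
  constructor
  · intro hx
    have hex : ∃ s, s ≤ x ∧ ∀ y, s ≤ y → y ≤ x → y ∈ S :=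
      ⟨x, le_rfl, fun y h1 h2 => by rwa [le_antisymm h2 h1]⟩
    obtain ⟨h1, h2⟩ := Nat.find_spec hex
    have hmin := fun m => Nat.find_min hex (m := m)
    set s := Nat.find hex
    have hsS : s ∈ S := h2 s le_rfl h1
    have hs : s ∈ E := by
      refine Finset.mem_filter.2 ⟨hD s hsS ?_, hsS⟩
      by_contra! hcon
      refine hmin (s - 1) (by omega) ⟨by omega, fun y hy hy' => ?_⟩
      rcases eq_or_ne y (s - 1) with rfl | hne
      · exact hcon.2
      · exact h2 y (by omega) hy'
    refine ⟨e.symm ⟨s, hs⟩, ?_, ?_⟩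
    · simpa using h1
    · apply Nat.le_findGreatest (hS x hx).le
      simpa using h2
  · rintro ⟨i, h1, h2⟩
    have := Nat.findGreatest_spec
      (P := fun m => ∀ y, (e i : ℕ) ≤ y → y ≤ m → y ∈ S) (m := (e i : ℕ)) (n := N) (hS _ (Finset.mem_filter.1 (e i).2).2).le
      (fun y h3 h4 => by
        rw [le_antisymm h4 h3]
        exact (Finset.mem_filter.1 (e i).2).2)
    exact this x h1 h2

theorem RePairing.erased_lt {σ : DyckWord} (p : RePairing σ) (t x : ℕ) (hx : x ∈ p.erased t) :
    x < σ.toList.length := by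
  obtain ⟨i, _, rfl | rfl⟩ := hx <;> exact Fin.isLt _

theorem DyckWord.width_le_of_rePairing {σ : DyckWord} (p : RePairing σ) {m : ℕ}
    (h : ∀ t ≤ σ.semilength, setWidth (p.erased t) ≤ m) : σ.width ≤ m := by
  have h₁ : σ.width ≤ p.width := Nat.sInf_le ⟨p, rfl⟩
  refine h₁.trans (Finset.sup_le fun t ht => h t ?_)
  simpa [Nat.lt_succ_iff] using ht

theorem DyckWord.width_le_length (σ : DyckWord) : σ.width ≤ σ.toList.length := by
  by_cases h : Nonempty (RePairing σ)
  · obtain ⟨p⟩ := h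
    refine width_le_of_rePairing p fun t _ => ?_
    have := setWidth_le_card_starts (p.erased_lt t) (Finset.range σ.toList.length)
      fun x hx _ => Finset.mem_range.2 (p.erased_lt t x hx)
    simpa using this
  -- The infimum of the empty set of naturals is `0`, so the existence of a re-pairing need not be
  -- shown here.
  · have : IsEmpty (RePairing σ) := not_nonempty_iff.1 h
    simp [DyckWord.width, Set.range_eq_empty]

/-! ### Monotone paths -/

theorem mem_zip_tail_iff {α : Type*} {l : List α} {i j : α} :
    (i, j) ∈ l.zip l.tail ↔ ∃ m, ∃ h : m + 1 < l.length, l[m] = i ∧ l[m + 1] = j := by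
  rw [List.mem_iff_getElem]
  constructor
  · rintro ⟨m, hm, h⟩
    simp only [List.length_zip, List.length_tail] at hm
    simp only [List.getElem_zip, List.getElem_tail, Prod.mk.injEq] at h
    exact ⟨m, by omega, h⟩
  · rintro ⟨m, hm, rfl, rfl⟩
    exact ⟨m, by simp; omega, by simp⟩

theorem exists_succ_of_mem {α : Type*} {l : List α} {j : α} (hj : j ∈ l) (hlast : j ∉ l.getLast?) :
    ∃ k, (j, k) ∈ l.zip l.tail := by
  obtain ⟨m, hm, rfl⟩ := List.mem_iff_getElem.1 hj
  have : m + 1 < l.length := by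
    by_contra hcon
    refine hlast ?_
    rw [List.getLast?_eq_getElem?, show l.length - 1 = m by omega]
    simp [hm]
  exact ⟨_, mem_zip_tail_iff.2 ⟨m, this, rfl, rfl⟩⟩

theorem exists_pred_of_mem {α : Type*} {l : List α} {j : α} (hj : j ∈ l) (hhead : j ∉ l.head?) :
    ∃ k, (k, j) ∈ l.zip l.tail := by
  obtain ⟨m, hm, rfl⟩ := List.mem_iff_getElem.1 hj
  rcases m with _ | m
  · refine absurd ?_ hhead
    rw [List.head?_eq_getElem?]
    simp [hm]
  · exact ⟨_, mem_zip_tail_iff.2 ⟨m, hm, rfl, rfl⟩⟩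

section Chain

variable {α : Type*} [Preorder α] {l : List α} {i i' j j' : α}

theorem List.IsChain.getElem_inj (hl : l.IsChain (· < ·)) {m m' : ℕ} (h : m < l.length)
    (h' : m' < l.length) (he : l[m] = l[m']) : m = m' :=
  (List.Nodup.getElem_inj_iff (hl.pairwise.imp fun h => h.ne)).1 he

theorem List.IsChain.pred_unique (hl : l.IsChain (· < ·)) (h : (i, j) ∈ l.zip l.tail)
    (h' : (i', j) ∈ l.zip l.tail) : i = i' := by
  obtain ⟨m, hm, rfl, rfl⟩ := mem_zip_tail_iff.1 h
  obtain ⟨m', hm', rfl, he⟩ := mem_zip_tail_iff.1 h'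
  obtain rfl : m' = m := by have := hl.getElem_inj hm' hm he; omega
  rfl

theorem List.IsChain.succ_unique (hl : l.IsChain (· < ·)) (h : (i, j) ∈ l.zip l.tail)
    (h' : (i, j') ∈ l.zip l.tail) : j = j' := by
  obtain ⟨m, hm, rfl, rfl⟩ := mem_zip_tail_iff.1 h
  obtain ⟨m', hm', he, rfl⟩ := mem_zip_tail_iff.1 h'
  obtain rfl := hl.getElem_inj (by omega) (by omega) he
  rfl

end Chain

/-! ### Words with Parikh image in the universal one-counter set -/

/-- The word `w` contains a letter of an edge entering `k`. -/
def HasIn {n : ℕ} (w : List (OCLetter n)) (k : Fin n) : Prop :=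
  ∃ i h, OCLetter.c i k h ∈ w

/-- The word `w` contains a letter of an edge leaving `k`. -/
def HasOut {n : ℕ} (w : List (OCLetter n)) (k : Fin n) : Prop :=
  ∃ j h, OCLetter.c k j h ∈ w

/-- The Parikh vector of `w` lies in the universal one-counter set. -/
def IsUWord {n : ℕ} (w : List (OCLetter n)) : Prop :=
  (fun a => w.count a) ∈ universalOneCounterSet n

section Words

variable {n : ℕ} {u v w y : List (OCLetter n)} {k : Fin n}

theorem hasIn_append : HasIn (u ++ v) k ↔ HasIn u k ∨ HasIn v k := by
  simp only [HasIn, List.mem_append]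
  grind

theorem hasOut_append : HasOut (u ++ v) k ↔ HasOut u k ∨ HasOut v k := by
  simp only [HasOut, List.mem_append]
  grind

theorem IsUWord.count_c_le (hw : IsUWord w) (i j : Fin n) (h : i < j) :
    w.count (OCLetter.c i j h) ≤ 1 := by
  have : w.count (OCLetter.c i j h) = 0 ∨ w.count (OCLetter.c i j h) = 1 := hw.1.1 i j h
  omega

theorem IsUWord.count_c_eq_one_iff (hw : IsUWord w) {i j : Fin n} {h : i < j} :
    w.count (OCLetter.c i j h) = 1 ↔ OCLetter.c i j h ∈ w := by
  have := hw.count_c_le i j h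
  rw [← List.count_pos_iff]
  omega

theorem IsUWord.hasIn_iff_hasOut (hw : IsUWord w) (h0 : 0 < (k : ℕ)) (hn : (k : ℕ) + 1 < n) :
    HasIn w k ↔ HasOut w k := by
  obtain ⟨l, hl, ⟨s, hs, hs0⟩, ⟨t, ht, htn⟩, hy⟩ := hw.1.2
  have hk0 : k ∉ l.head? := fun hk => by
    rw [Option.mem_def] at hk hs
    rw [hk] at hs
    obtain rfl := Option.some.inj hs
    omega
  have hkn : k ∉ l.getLast? := fun hk => by
    rw [Option.mem_def] at hk ht
    rw [hk] at ht
    obtain rfl := Option.some.inj ht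
    omega
  constructor
  · rintro ⟨i, h, hi⟩
    have hi' := (hy i k h).1 (hw.count_c_eq_one_iff.2 hi)
    obtain ⟨m, hm, rfl, rfl⟩ := mem_zip_tail_iff.1 hi'
    obtain ⟨j, hj⟩ := exists_succ_of_mem (List.getElem_mem hm) hkn
    have hlt : l[m + 1] < j := by
      obtain ⟨m', hm', h1, rfl⟩ := mem_zip_tail_iff.1 hj
      rw [← h1]
      exact List.isChain_iff_getElem.1 hl m' hm'
    exact ⟨j, hlt, hw.count_c_eq_one_iff.1 ((hy _ _ hlt).2 hj)⟩
  · rintro ⟨j, h, hj⟩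
    have hj' := (hy k j h).1 (hw.count_c_eq_one_iff.2 hj)
    obtain ⟨m, hm, rfl, rfl⟩ := mem_zip_tail_iff.1 hj'
    obtain ⟨i, hi⟩ := exists_pred_of_mem (List.getElem_mem (by omega : m < l.length)) hk0
    have hlt : i < l[m] := by
      obtain ⟨m', hm', rfl, h1⟩ := mem_zip_tail_iff.1 hi
      rw [← h1]
      exact List.isChain_iff_getElem.1 hl m' hm'
    exact ⟨i, hlt, hw.count_c_eq_one_iff.1 ((hy _ _ hlt).2 hi)⟩

theorem IsUWord.not_hasIn_both (hw : IsUWord (u ++ v)) : ¬ (HasIn u k ∧ HasIn v k) := by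
  rintro ⟨⟨i, h, hi⟩, ⟨i', h', hi'⟩⟩
  obtain ⟨l, hl, -, -, hy⟩ := hw.1.2
  obtain rfl : i = i' := hl.pred_unique
    ((hy i k h).1 (hw.count_c_eq_one_iff.2 (by simp [hi])))
    ((hy i' k h').1 (hw.count_c_eq_one_iff.2 (by simp [hi'])))
  have h1 := hw.count_c_le i k h
  rw [List.count_append] at h1
  have h2 := List.count_pos_iff.2 hi
  have h3 := List.count_pos_iff.2 hi'
  omega

theorem IsUWord.not_hasOut_both (hw : IsUWord (u ++ v)) : ¬ (HasOut u k ∧ HasOut v k) := by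
  rintro ⟨⟨i, h, hi⟩, ⟨i', h', hi'⟩⟩
  obtain ⟨l, hl, -, -, hy⟩ := hw.1.2
  obtain rfl : i = i' := hl.succ_unique
    ((hy k i h).1 (hw.count_c_eq_one_iff.2 (by simp [hi])))
    ((hy k i' h').1 (hw.count_c_eq_one_iff.2 (by simp [hi'])))
  have h1 := hw.count_c_le k i h
  rw [List.count_append] at h1
  have h2 := List.count_pos_iff.2 hi
  have h3 := List.count_pos_iff.2 hi'
  omega

theorem IsUWord.hasIn_of_mem (hw : IsUWord w) (hk : OCLetter.a k ∈ w) (h0 : 0 < (k : ℕ)) :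
    HasIn w k := by
  obtain ⟨i, h, hi⟩ := (hw.2.2 k (List.count_pos_iff.2 hk)).1 h0
  exact ⟨i, h, hw.count_c_eq_one_iff.1 hi⟩

/-- The signed sum of the counts of the letters `a_i` with `i ∈ T`. -/
def signedCount (T : Finset (Fin n)) (w : List (OCLetter n)) : ℤ :=
  ∑ i ∈ T, (-1 : ℤ) ^ (i : ℕ) * (w.count (OCLetter.a i) : ℤ)

theorem signedCount_append (T : Finset (Fin n)) :
    signedCount T (u ++ v) = signedCount T u + signedCount T v := by
  simp [signedCount, mul_add, Finset.sum_add_distrib]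

theorem signedCount_flatten_replicate (T : Finset (Fin n)) (m : ℕ) :
    signedCount T (List.replicate m y).flatten = m * signedCount T y := by
  induction m with
  | zero => simp [signedCount]
  | succ m ih =>
    rw [List.replicate_succ, List.flatten_cons, signedCount_append, ih]
    push_cast
    ring

theorem IsUWord.signedCount_univ (hw : IsUWord w) : signedCount Finset.univ w = 0 := hw.2.1.1

theorem IsUWord.signedCount_Iic_nonneg (hw : IsUWord w) (k : Fin n) :
    0 ≤ signedCount (Finset.Iic k) w := by
  by_cases hk : (k : ℕ) + 1 < n
  · exact hw.2.1.2 k hk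
  · have : Finset.Iic k = Finset.univ := by
      ext i
      simp only [Finset.mem_Iic, Finset.mem_univ, iff_true, Fin.le_def]
      omega
    rw [this, hw.signedCount_univ]

/-- Pumpable factors contain no edge letters. -/
theorem c_notMem_of_pump (h : ∀ m : ℕ, IsUWord (u ++ (List.replicate m y).flatten ++ v))
    (i j : Fin n) (hij : i < j) : OCLetter.c i j hij ∉ y := by
  intro hy
  have h2 := (h 2).count_c_le i j hij
  have := List.count_pos_iff.2 hy
  simp [List.replicate_succ] at h2
  omega

theorem signedCount_univ_of_pump
    (h : ∀ m : ℕ, IsUWord (u ++ (List.replicate m y).flatten ++ v)) :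
    signedCount Finset.univ y = 0 := by
  have h0 := (h 0).signedCount_univ
  have h1 := (h 1).signedCount_univ
  simp only [signedCount_append, signedCount_flatten_replicate] at h0 h1
  push_cast at h0 h1
  linarith

/-- A negative prefix sum on `y` would, after enough repetitions, outweigh the fixed contribution
`d` of `u` and `v`. -/
theorem signedCount_Iic_nonneg_of_pump
    (h : ∀ m : ℕ, IsUWord (u ++ (List.replicate m y).flatten ++ v)) (k : Fin n) :
    0 ≤ signedCount (Finset.Iic k) y := by
  by_contra! hneg
  set d := signedCount (Finset.Iic k) u + signedCount (Finset.Iic k) v with hd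
  have h1 := (h (d.toNat + 1)).signedCount_Iic_nonneg k
  simp only [signedCount_append, signedCount_flatten_replicate] at h1
  push_cast at h1
  have h2 := Int.self_le_toNat d
  nlinarith

/-- The total over `y` vanishes and the complementary prefix sum is nonnegative. In this form,
closing brackets on a cycle outweigh opening ones from any vertex onwards. -/
theorem signedCount_Ici_nonpos_of_pump
    (h : ∀ m : ℕ, IsUWord (u ++ (List.replicate m y).flatten ++ v)) (k : Fin n) :
    signedCount (Finset.Ici k) y ≤ 0 := by
  have huniv := signedCount_univ_of_pump h
  have hsplit : signedCount (Finset.Iio k) y + signedCount (Finset.Ici k) y =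
      signedCount Finset.univ y := by
    rw [signedCount, signedCount, signedCount, ← Finset.sum_union]
    · congr 1
      ext i
      simp [lt_or_ge]
    · rw [Finset.disjoint_left]
      intro i hi hi'
      simp only [Finset.mem_Iio, Finset.mem_Ici] at hi hi'
      exact absurd hi (not_lt.2 hi')
  suffices 0 ≤ signedCount (Finset.Iio k) y by linarith
  by_cases hk : (k : ℕ) = 0
  · have : Finset.Iio k = ∅ := by
      ext i
      simp only [Finset.mem_Iio, Fin.lt_def]
      simp [hk]
    simp [this, signedCount]
  · have : Finset.Iio k = Finset.Iic ⟨(k : ℕ) - 1, by omega⟩ := by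
      ext i
      simp only [Finset.mem_Iio, Finset.mem_Iic, Fin.lt_def, Fin.le_def]
      omega
    rw [this]
    exact signedCount_Iic_nonneg_of_pump h _

end Words

/-! ### Vertices forced by a state -/

section Forced

variable {n : ℕ} {Q : Type*}

/-- The word `u` leads from a start state to `q`. -/
def FromStart {α : Type*} (A : NFA α Q) (u : List α) (q : Q) : Prop :=
  ∃ s ∈ A.start, RunIn A Set.univ s u q

/-- The word `v` leads from `q` to an accepting state. -/
def ToAccept {α : Type*} (A : NFA α Q) (q : Q) (v : List α) : Prop :=
  ∃ f ∈ A.accept, RunIn A Set.univ q v f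

/-- The inner vertices that lie on the path of every accepted word with a run through `q`. -/
def forced (A : NFA (OCLetter n) Q) (q : Q) : Set (Fin n) :=
  {k | (0 < (k : ℕ) ∧ (k : ℕ) + 1 < n) ∧
    ∀ u v, FromStart A u q → ToAccept A q v → HasIn (u ++ v) k}

variable {A : NFA (OCLetter n) Q} {q : Q} {u v y : List (OCLetter n)} {k : Fin n}

theorem FromStart.append {r : Q} (hu : FromStart A u q) (hy : RunIn A Set.univ q y r) :
    FromStart A (u ++ y) r := by
  obtain ⟨s, hs, h⟩ := hu
  exact ⟨s, hs, h.append hy⟩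

theorem ToAccept.append {r : Q} (hy : RunIn A Set.univ q y r) (hv : ToAccept A r v) :
    ToAccept A q (y ++ v) := by
  obtain ⟨f, hf, h⟩ := hv
  exact ⟨f, hf, hy.append h⟩

theorem FromStart.isUWord (hA : ∀ w ∈ A.accepts, IsUWord w) (hu : FromStart A u q)
    (hv : ToAccept A q v) : IsUWord (u ++ v) := by
  obtain ⟨s, hs, h⟩ := hu
  obtain ⟨f, hf, h'⟩ := hv
  exact hA _ (mem_accepts_iff_runIn.2 ⟨s, hs, f, hf, h.append h'⟩)

theorem RunIn.replicate {α : Type*} {A : NFA α Q} {y : List α} (hy : RunIn A Set.univ q y q)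
    (m : ℕ) : RunIn A Set.univ q (List.replicate m y).flatten q := by
  induction m with
  | zero => exact .nil trivial
  | succ m ih => exact hy.append ih

theorem RunIn.pump (hA : ∀ w ∈ A.accepts, IsUWord w) (hu : FromStart A u q)
    (hv : ToAccept A q v) (hy : RunIn A Set.univ q y q) (m : ℕ) :
    IsUWord (u ++ (List.replicate m y).flatten ++ v) :=
  (hu.append (hy.replicate m)).isUWord hA hv

theorem RunIn.c_notMem (hA : ∀ w ∈ A.accepts, IsUWord w) (hu : FromStart A u q)
    (hv : ToAccept A q v) (hy : RunIn A Set.univ q y q) (i j : Fin n) (h : i < j) :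
    OCLetter.c i j h ∉ y :=
  c_notMem_of_pump (hy.pump hA hu hv) i j h

theorem RunIn.not_hasIn (hA : ∀ w ∈ A.accepts, IsUWord w) (hu : FromStart A u q)
    (hv : ToAccept A q v) (hy : RunIn A Set.univ q y q) : ¬ HasIn y k := by
  rintro ⟨i, h, hi⟩
  exact hy.c_notMem hA hu hv i k h hi

/-- If `u` holds exactly one of the two edges at `k`, then `v` holds exactly the other. Any other
prefix `u'` into `q` must also complete `v`, so it holds an edge at `k`; hence so does `u' ++ v'`,
and inner vertices cannot have just one. -/
theorem mem_forced_of_hasIn_ne_hasOut (h : ¬ (HasIn u k ↔ HasOut u k))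
    (hA : ∀ w ∈ A.accepts, IsUWord w) (h0 : 0 < (k : ℕ)) (hn : (k : ℕ) + 1 < n)
    (hu : FromStart A u q) (hv : ToAccept A q v) : k ∈ forced A q := by
  refine ⟨⟨h0, hn⟩, fun u' v' hu' hv' => ?_⟩
  have h1 := (hu.isUWord hA hv).hasIn_iff_hasOut h0 hn
  have h2 := (hu.isUWord hA hv).not_hasIn_both (k := k)
  have h3 := (hu.isUWord hA hv).not_hasOut_both (k := k)
  have h4 := (hu'.isUWord hA hv).hasIn_iff_hasOut h0 hn
  have h5 := (hu'.isUWord hA hv').hasIn_iff_hasOut h0 hn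
  rw [hasIn_append, hasOut_append] at h1 h4 h5
  rw [hasIn_append]
  grind

/-- Since `u` uses `a_k` without supplying its incoming edge, every suffix accepted from `q` must
supply it. -/
theorem mem_forced_of_mem_left (hku : OCLetter.a k ∈ u) (h : ¬ HasIn u k)
    (hA : ∀ w ∈ A.accepts, IsUWord w) (h0 : 0 < (k : ℕ)) (hn : (k : ℕ) + 1 < n)
    (hu : FromStart A u q) : k ∈ forced A q := by
  refine ⟨⟨h0, hn⟩, fun u' v' hu' hv' => ?_⟩
  have h1 := (hu.isUWord hA hv').hasIn_of_mem (by simp [hku]) h0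
  rw [hasIn_append] at *
  tauto

theorem mem_forced_of_mem_right (hkv : OCLetter.a k ∈ v) (h : ¬ HasIn v k)
    (hA : ∀ w ∈ A.accepts, IsUWord w) (h0 : 0 < (k : ℕ)) (hn : (k : ℕ) + 1 < n)
    (hv : ToAccept A q v) : k ∈ forced A q := by
  refine ⟨⟨h0, hn⟩, fun u' v' hu' hv' => ?_⟩
  have h1 := (hu'.isUWord hA hv).hasIn_of_mem (by simp [hkv]) h0
  rw [hasIn_append] at *
  tauto

/-- Inserting the cycle into any accepting run through `q` makes `k` necessary, and the cycle itself
carries no edge letter. -/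
theorem mem_forced_of_mem_cycle (hy : RunIn A Set.univ q y q) (hk : OCLetter.a k ∈ y)
    (hA : ∀ w ∈ A.accepts, IsUWord w) (h0 : 0 < (k : ℕ)) (hn : (k : ℕ) + 1 < n) :
    k ∈ forced A q := by
  refine ⟨⟨h0, hn⟩, fun u' v' hu' hv' => ?_⟩
  have h1 := ((hu'.append hy).isUWord hA hv').hasIn_of_mem (by simp [hk]) h0
  have h2 := hy.not_hasIn hA hu' hv' (k := k)
  rw [hasIn_append, hasIn_append] at h1
  rw [hasIn_append]
  tauto

/-- A vertex whose letter occurs on a cycle before `q` is forced by `q`, or the edges at that vertex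
have been read before `q`. -/
theorem hasOut_of_cycle_left {r : Q} {u₁ u₂ : List (OCLetter n)} (hk : k ∉ forced A q)
    (hy : RunIn A Set.univ r y r) (hky : OCLetter.a k ∈ y)
    (hA : ∀ w ∈ A.accepts, IsUWord w) (h0 : 0 < (k : ℕ)) (hn : (k : ℕ) + 1 < n)
    (hu₁ : FromStart A u₁ r) (hu₂ : RunIn A Set.univ r u₂ q) (hv : ToAccept A q v) :
    HasOut (u₁ ++ u₂) k := by
  have hyi := hy.not_hasIn hA hu₁ (hv.append hu₂) (k := k)
  by_contra hcon
  -- With no outgoing edge before `q` there is no incoming one either, as `k` is unforced. Inserting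
  -- the cycle then puts `a_k` before `q` without its edge, which forces `k` after all.
  have hi : ¬ HasIn (u₁ ++ u₂) k := fun h =>
    hk (mem_forced_of_hasIn_ne_hasOut (by tauto) hA h0 hn (hu₁.append hu₂) hv)
  refine hk (mem_forced_of_mem_left (u := u₁ ++ y ++ u₂) (by simp [hky]) ?_ hA h0 hn
    ((hu₁.append hy).append hu₂))
  rw [hasIn_append] at hi
  rw [hasIn_append, hasIn_append]
  tauto

/-- A vertex whose letter occurs on a cycle after `q` is forced by `q`, or the edges at that vertex
have not been read before `q`. -/
theorem not_hasOut_of_cycle_right {r : Q} {v₁ v₂ : List (OCLetter n)} (hk : k ∉ forced A q)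
    (hy : RunIn A Set.univ r y r) (hky : OCLetter.a k ∈ y)
    (hA : ∀ w ∈ A.accepts, IsUWord w) (h0 : 0 < (k : ℕ)) (hn : (k : ℕ) + 1 < n)
    (hu : FromStart A u q) (hv₁ : RunIn A Set.univ q v₁ r) (hv₂ : ToAccept A r v₂) :
    ¬ HasOut u k := by
  have hyi := hy.not_hasIn hA (hu.append hv₁) hv₂ (k := k)
  -- Otherwise the suffix with the cycle inserted would contain `a_k` without its edge and force
  -- `k`. So the incoming edge is read after `q`, and an outgoing edge before `q` would split the
  -- two edges.
  have hi : HasIn (v₁ ++ v₂) k := by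
    by_contra hcon
    refine hk (mem_forced_of_mem_right (v := v₁ ++ y ++ v₂) (by simp [hky]) ?_ hA h0 hn
      (by simpa using (hv₂.append hy).append hv₁))
    rw [hasIn_append] at hcon
    rw [hasIn_append, hasIn_append]
    tauto
  have h1 := (hu.isUWord hA (hv₂.append hv₁)).not_hasIn_both (k := k)
  intro hcon
  exact hk (mem_forced_of_hasIn_ne_hasOut (by tauto) hA h0 hn hu (hv₂.append hv₁))

end Forced

/-! ### Vectors built from a path and a placement of a Dyck word -/

/-- The vector with the edges of the path `l` and with `x i` copies of `a_i`. -/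
def pathVector {n : ℕ} (l : List (Fin n)) (x : Fin n → ℕ) : OCLetter n → ℕ
  | .c i j _ => if (i, j) ∈ l.zip l.tail then 1 else 0
  | .a i => x i

theorem pathVector_mem {n : ℕ} {l : List (Fin n)} {x : Fin n → ℕ} (hl : l.IsChain (· < ·))
    (hs : ∃ s ∈ l.head?, (s : ℕ) = 0) (ht : ∃ t ∈ l.getLast?, (t : ℕ) + 1 = n)
    (hx : IsBalancedVector n x) (hxl : ∀ j, 0 < x j → j ∈ l) :
    pathVector l x ∈ universalOneCounterSet n := by
  have hlt : ∀ i j, (i, j) ∈ l.zip l.tail → i < j := by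
    intro i j h
    obtain ⟨m, hm, rfl, rfl⟩ := mem_zip_tail_iff.1 h
    exact List.isChain_iff_getElem.1 hl m hm
  refine ⟨⟨fun i j _ => ?_, l, hl, hs, ht, fun i j _ => ?_⟩, hx,
    fun j hj => ⟨fun h => ?_, fun h => ?_⟩⟩
  · simp only [pathVector]
    split_ifs <;> simp
  · simp only [pathVector]
    split_ifs with h <;> simp [h]
  · obtain ⟨i, hi⟩ := exists_pred_of_mem (hxl j hj) (fun hj' => by
      obtain ⟨s, hs, hs0⟩ := hs
      obtain rfl := Option.mem_unique hs hj'
      omega)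
    exact ⟨i, hlt _ _ hi, by simp [pathVector, hi]⟩
  · obtain ⟨i, hi⟩ := exists_succ_of_mem (hxl j hj) (fun hj' => by
      obtain ⟨s, hs, hs0⟩ := ht
      obtain rfl := Option.mem_unique hs hj'
      omega)
    exact ⟨i, hlt _ _ hi, by simp [pathVector, hi]⟩

/-- A placement of the letters of a Dyck word at inner vertices: opening brackets at even vertices
and closing brackets at odd ones. -/
structure IsPlacement {n : ℕ} (σ : DyckWord) (pos : Fin σ.toList.length → Fin n) : Prop where
  strictMono : StrictMono pos
  pos_pos : ∀ k, 0 < (pos k : ℕ)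
  succ_lt : ∀ k, (pos k : ℕ) + 1 < n
  even_of_U : ∀ k, σ.toList.get k = DyckStep.U → Even (pos k : ℕ)
  odd_of_D : ∀ k, σ.toList.get k = DyckStep.D → Odd (pos k : ℕ)

/-- The path through the vertices of a placement. -/
def placementPath {n N : ℕ} (hn : 0 < n) (pos : Fin N → Fin n) : List (Fin n) :=
  ⟨0, hn⟩ :: (List.ofFn pos ++ [⟨n - 1, by omega⟩])

/-- The vector of a placement in which every letter is repeated `M` times. -/
def placementVector {n N : ℕ} (hn : 0 < n) (pos : Fin N → Fin n) (M : ℕ) : OCLetter n → ℕ :=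
  pathVector (placementPath hn pos) fun j => ∑ k, if pos k = j then M else 0

theorem sum_sign_take (l : List DyckStep) (r : ℕ) :
    (∑ k : Fin l.length, if (k : ℕ) < r then (if l.get k = DyckStep.U then 1 else -1 : ℤ) else 0) =
      ((l.take r).count DyckStep.U : ℤ) - (l.take r).count DyckStep.D := by
  induction l generalizing r with
  | nil => simp
  | cons a l ih =>
    rcases r with _ | r
    · simp
    · refine (Fin.sum_univ_succ (n := l.length) _).trans ?_
      change (if 0 < r + 1 then (if a = DyckStep.U then 1 else -1 : ℤ) else 0) +
        ∑ k : Fin l.length, (if (k : ℕ) + 1 < r + 1 then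
          (if l.get k = DyckStep.U then 1 else -1 : ℤ) else 0) = _
      simp only [Nat.add_lt_add_iff_right]
      rw [ih r, List.take_succ_cons, List.count_cons, List.count_cons]
      cases a <;> simp <;> ring

theorem card_get_eq (l : List DyckStep) (a : DyckStep) :
    Fintype.card {k : Fin l.length // l.get k = a} = l.count a := by
  rw [Fintype.card_subtype, Finset.card_filter]
  induction l with
  | nil => simp
  | cons b l ih =>
    refine (Fin.sum_univ_succ (n := l.length) _).trans ?_
    change (if b = a then 1 else 0) + ∑ k : Fin l.length, (if l.get k = a then 1 else 0) = _
    rw [ih, List.count_cons, add_comm]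
    simp

section Placement

variable {n : ℕ} {σ : DyckWord} {pos : Fin σ.toList.length → Fin n}

theorem placement_sum (M : ℕ) (T : Finset (Fin n)) :
    ∑ i ∈ T, (-1 : ℤ) ^ (i : ℕ) * ((∑ k, if pos k = i then M else 0 : ℕ) : ℤ) =
      ∑ k, if pos k ∈ T then (-1 : ℤ) ^ (pos k : ℕ) * M else 0 := by
  push_cast
  simp_rw [Finset.mul_sum]
  rw [Finset.sum_comm]
  refine Finset.sum_congr rfl fun k _ => ?_
  simp

theorem IsPlacement.sign (h : IsPlacement σ pos) (k : Fin σ.toList.length) :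
    (-1 : ℤ) ^ (pos k : ℕ) = if σ.toList.get k = DyckStep.U then 1 else -1 := by
  split_ifs with hk
  · exact (h.even_of_U k hk).neg_one_pow
  · exact (h.odd_of_D k ((DyckStep.dichotomy _).resolve_left hk)).neg_one_pow

/-- As `pos` is increasing, an initial segment of vertices carries a prefix of `σ`; the signed sum
is `M` times the height of that prefix. -/
theorem IsPlacement.isBalancedVector (h : IsPlacement σ pos) (M : ℕ) :
    IsBalancedVector n fun j => ∑ k, if pos k = j then M else 0 := by
  have key : ∀ (T : Finset (Fin n)) (r : ℕ), (∀ k, pos k ∈ T ↔ (k : ℕ) < r) →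
      ∑ i ∈ T, (-1 : ℤ) ^ (i : ℕ) * ((∑ k, if pos k = i then M else 0 : ℕ) : ℤ) =
        (((σ.toList.take r).count DyckStep.U : ℤ) - (σ.toList.take r).count DyckStep.D) * M := by
    intro T r hT
    rw [placement_sum, ← sum_sign_take, Finset.sum_mul]
    refine Finset.sum_congr rfl fun k _ => ?_
    simp only [hT, h.sign, ite_mul, zero_mul]
  constructor
  · rw [key Finset.univ σ.toList.length (by simp)]
    simp [σ.count_U_eq_count_D]
  · intro m _
    have hr : ∃ r : ℕ, ∀ k, pos k ∈ Finset.Iic m ↔ (k : ℕ) < r := by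
      by_cases hall : ∃ k, m < pos k
      · obtain ⟨k₀, hk₀, hmin⟩ := (Finset.univ.filter fun k => m < pos k).exists_minimal
          (by obtain ⟨k, hk⟩ := hall; exact ⟨k, by simpa using hk⟩)
        refine ⟨k₀, fun k => ?_⟩
        simp only [Finset.mem_filter, Finset.mem_univ, true_and] at hk₀ hmin
        rw [Finset.mem_Iic, ← Fin.lt_def]
        constructor
        · intro hk
          exact h.strictMono.lt_iff_lt.1 (hk.trans_lt hk₀)
        · intro hk
          by_contra! hcon
          exact absurd (hmin hcon hk.le) (not_le.2 hk)
      · push Not at hall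
        exact ⟨σ.toList.length, fun k => by simp [hall k]⟩
    obtain ⟨r, hr⟩ := hr
    rw [key _ r hr]
    have := σ.count_D_le_count_U r
    exact mul_nonneg (by omega) (by positivity)

theorem IsPlacement.isChain (h : IsPlacement σ pos) (hn : 0 < n) (hn2 : 2 ≤ n) :
    (placementPath hn pos).IsChain (· < ·) := by
  rw [List.isChain_iff_pairwise, placementPath, List.pairwise_cons, List.pairwise_append,
    List.pairwise_ofFn]
  refine ⟨fun a ha => ?_, fun i j hij => h.strictMono hij, List.pairwise_singleton _ _,
    fun a ha b hb => ?_⟩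
  · simp only [List.mem_append, List.mem_ofFn, List.mem_singleton] at ha
    rcases ha with ⟨k, rfl⟩ | rfl
    · exact h.pos_pos k
    · simp only [Fin.lt_def]; omega
  · simp only [List.mem_ofFn, List.mem_singleton] at ha hb
    obtain ⟨k, rfl⟩ := ha
    subst hb
    have := h.succ_lt k
    simp only [Fin.lt_def]; omega

theorem mem_placementPath (hn : 0 < n) (k : Fin σ.toList.length) :
    pos k ∈ placementPath hn pos := by
  simp [placementPath]

theorem placementVector_mem (h : IsPlacement σ pos) (hn : 0 < n) (hn2 : 2 ≤ n) (M : ℕ) :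
    placementVector hn pos M ∈ universalOneCounterSet n := by
  refine pathVector_mem (h.isChain hn hn2) ⟨⟨0, hn⟩, by simp [placementPath], rfl⟩
    ⟨⟨n - 1, by omega⟩, ?_, by simp; omega⟩ (h.isBalancedVector M) fun j hj => ?_
  · simp [placementPath, List.getLast?_cons, List.getLast?_append]
  · obtain ⟨k, _, hk⟩ := Finset.exists_ne_zero_of_sum_ne_zero hj.ne'
    obtain rfl : pos k = j := by
      by_contra hne
      simp [hne] at hk
    exact mem_placementPath hn k

theorem placement_edge (hn : 0 < n) (k : ℕ) (hk : k + 1 < σ.toList.length) :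
    (pos ⟨k, by omega⟩, pos ⟨k + 1, hk⟩) ∈
      (placementPath hn pos).zip (placementPath hn pos).tail := by
  rw [mem_zip_tail_iff]
  refine ⟨k + 1, by simp [placementPath]; omega, ?_, ?_⟩
  · simp [placementPath, show k < σ.toList.length by omega]
  · simp [placementPath, hk]

variable {w u v : List (OCLetter n)} {M : ℕ}

theorem count_a_placement (h : IsPlacement σ pos) {hn : 0 < n}
    (hw : (fun a => w.count a) = placementVector hn pos M) (k : Fin σ.toList.length) :
    w.count (OCLetter.a (pos k)) = M := by
  have := congrFun hw (OCLetter.a (pos k))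
  simpa [placementVector, pathVector, h.strictMono.injective.eq_iff] using this

theorem exists_of_a_mem_placement {hn : 0 < n}
    (hw : (fun a => w.count a) = placementVector hn pos M) {j : Fin n} (hj : OCLetter.a j ∈ w) :
    ∃ k, pos k = j := by
  have h := congrFun hw (OCLetter.a j)
  have h' := List.count_pos_iff.2 hj
  by_contra! hcon
  simp [placementVector, pathVector, hcon] at h
  omega

theorem c_mem_placement_iff {hn : 0 < n}
    (hw : (fun a => w.count a) = placementVector hn pos M) {i j : Fin n} {hij : i < j} :
    OCLetter.c i j hij ∈ w ↔ (i, j) ∈ (placementPath hn pos).zip (placementPath hn pos).tail := by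
  have h := congrFun hw (OCLetter.c i j hij)
  simp only [placementVector, pathVector] at h
  rw [← List.count_pos_iff, h]
  split_ifs with h' <;> simp [h']

/-- Consecutive placed vertices are joined by a single path edge, so one letter decides both sides.
This links the status of adjacent brackets. -/
theorem hasOut_iff_hasIn_succ (h : IsPlacement σ pos) {hn : 0 < n} (hn2 : 2 ≤ n)
    (hw : (fun a => w.count a) = placementVector hn pos M) (huw : u ⊆ w)
    (k : ℕ) (hk : k + 1 < σ.toList.length) :
    HasOut u (pos ⟨k, by omega⟩) ↔ HasIn u (pos ⟨k + 1, hk⟩) := by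
  have hc := h.isChain hn hn2
  have he := placement_edge (pos := pos) hn k hk
  constructor
  · rintro ⟨j, hj, hju⟩
    have h1 := (c_mem_placement_iff hw).1 (huw hju)
    obtain rfl := hc.succ_unique h1 he
    exact ⟨_, hj, hju⟩
  · rintro ⟨i, hi, hiu⟩
    have h1 := (c_mem_placement_iff hw).1 (huw hiu)
    obtain rfl := hc.pred_unique h1 he
    exact ⟨_, hi, hiu⟩

/-- The vertices forced by a state on a run of a placement word are vertices of the placement. -/
theorem forced_subset_range {Q : Type*} {A : NFA (OCLetter n) Q} {q : Q} {hn : 0 < n}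
    (hw : (fun a => (u ++ v).count a) = placementVector hn pos M) (hu : FromStart A u q)
    (hv : ToAccept A q v) : forced A q ⊆ Set.range pos := by
  rintro k ⟨⟨h0, h1⟩, h⟩
  obtain ⟨i, hi, hiw⟩ := h u v hu hv
  have he := (c_mem_placement_iff hw).1 hiw
  have hk := List.mem_of_mem_tail (List.of_mem_zip he).2
  simp only [placementPath, List.mem_cons, List.mem_append, List.mem_ofFn, List.not_mem_nil,
    or_false] at hk
  rcases hk with rfl | ⟨m, rfl⟩ | rfl
  · simp at h0
  · exact ⟨m, rfl⟩
  · simp at h1; omega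

end Placement

/-! ### From runs to re-pairings -/

theorem sum_map_letter_weight {α ι : Type*} [DecidableEq α] [Fintype ι] (f : ι → α) (e : ι → ℤ)
    (y : List α) :
    (y.map fun x => ∑ k, if x = f k then e k else 0).sum = ∑ k, e k * y.count (f k) := by
  induction y with
  | nil => simp
  | cons a y ih =>
    rw [List.map_cons, List.sum_cons, ih, ← Finset.sum_add_distrib]
    refine Finset.sum_congr rfl fun k _ => ?_
    rw [List.count_cons]
    by_cases h : a = f k
    · simp [h]; ring
    · simp [h]

section RePair

variable {n : ℕ} {σ : DyckWord} {pos : Fin σ.toList.length → Fin n} {Q : Type*}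
  {A : NFA (OCLetter n) Q} {w : List (OCLetter n)} {M : ℕ}

theorem IsPlacement.signedCount_Ici (h : IsPlacement σ pos) {y : List (OCLetter n)}
    (hy : ∀ j, OCLetter.a j ∈ y → ∃ k, pos k = j) (k₀ : Fin σ.toList.length) :
    signedCount (Finset.Ici (pos k₀)) y =
      ∑ k, if k₀ ≤ k then (if σ.toList.get k = DyckStep.U then 1 else -1 : ℤ) *
        y.count (OCLetter.a (pos k)) else 0 := by
  rw [signedCount, ← Finset.univ_inter (Finset.Ici (pos k₀)), ← Finset.sum_ite_mem]
  symm
  apply Fintype.sum_of_injective pos h.strictMono.injective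
  · intro j hj
    have : y.count (OCLetter.a j) = 0 := by
      rw [List.count_eq_zero]
      exact fun hjy => hj (hy j hjy)
    simp [this]
  · intro k
    simp only [Finset.mem_Ici, h.strictMono.le_iff_le, h.sign]

/-- The letters `a_i` and `a_j` lie on a common cycle at the state `q`. -/
def OnCycle (A : NFA (OCLetter n) Q) (q : Q) (i j : Fin n) : Prop :=
  ∃ y, RunIn A Set.univ q y q ∧ OCLetter.a i ∈ y ∧ OCLetter.a j ∈ y

/-- On a cycle, the opening brackets of a set `U` are outnumbered by the closing brackets of
a set `V` that contains all their possible partners on that cycle. -/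
theorem IsPlacement.cycle_weight_nonpos (h : IsPlacement σ pos) {u v y : List (OCLetter n)} {q : Q}
    (hA : ∀ w ∈ A.accepts, IsUWord w) (hu : FromStart A u q) (hv : ToAccept A q v)
    (hyr : RunIn A Set.univ q y q) (hy : ∀ j, OCLetter.a j ∈ y → ∃ k, pos k = j)
    (U V : Finset (Fin σ.toList.length)) (hU : ∀ k ∈ U, σ.toList.get k = DyckStep.U)
    (hV : ∀ k ∈ V, σ.toList.get k = DyckStep.D)
    (hUV : ∀ k ∈ U, ∀ l, k < l → σ.toList.get l = DyckStep.D →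
      OnCycle A q (pos k) (pos l) → l ∈ V) :
    ∑ k, ((if k ∈ U then 1 else 0) - (if k ∈ V then 1 else 0) : ℤ) *
      y.count (OCLetter.a (pos k)) ≤ 0 := by
  by_cases hall : ∃ k ∈ U, OCLetter.a (pos k) ∈ y
  -- Let `k₀` be the earliest bracket of `U` on the cycle. All closing brackets after it on the
  -- cycle belong to `V`, so the weight is bounded term by term by the signed sum from `pos k₀`
  -- onwards.
  · obtain ⟨k₀, hk₀, hmin⟩ := (U.filter fun k => OCLetter.a (pos k) ∈ y).exists_minimal
      (by obtain ⟨k, hk⟩ := hall; exact ⟨k, by simpa using hk⟩)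
    simp only [Finset.mem_filter] at hk₀ hmin
    refine le_trans ?_ (signedCount_Ici_nonpos_of_pump (hyr.pump hA hu hv) (pos k₀))
    rw [h.signedCount_Ici hy]
    refine Finset.sum_le_sum fun k _ => ?_
    by_cases hky : OCLetter.a (pos k) ∈ y
    · have hc : (0 : ℤ) ≤ y.count (OCLetter.a (pos k)) := by positivity
      rcases DyckStep.dichotomy (σ.toList.get k) with hk | hk
      · have hkV : k ∉ V := fun h' => by cases hk.symm.trans (hV k h')
        by_cases hkU : k ∈ U
        · have : k₀ ≤ k := by
            by_contra! hlt
            exact absurd (hmin ⟨hkU, hky⟩ hlt.le) (not_le.2 hlt)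
          simp only [hkU, hkV, this, hk, if_true, if_false]
          linarith
        · simp only [hkU, hkV, hk, if_true, if_false]
          split_ifs <;> linarith
      · have hkU : k ∉ U := fun h' => by cases hk.symm.trans (hU k h')
        by_cases hle : k₀ ≤ k
        · have hne : k₀ ≠ k := fun h' => hkU (h' ▸ hk₀.1)
          have hkV : k ∈ V := hUV k₀ hk₀.1 k (lt_of_le_of_ne hle hne) hk ⟨y, hyr, hk₀.2, hky⟩
          simp only [hkU, hkV, hle, hk, if_true, if_false, reduceCtorEq]
          linarith
        · simp only [hkU, hle, if_false]
          split_ifs <;> linarith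
    · rw [List.count_eq_zero.2 hky]
      simp
  · push Not at hall
    refine Finset.sum_nonpos fun k _ => ?_
    by_cases hkU : k ∈ U
    · rw [List.count_eq_zero.2 (hall k hkU)]
      simp
    · have hc : (0 : ℤ) ≤ y.count (OCLetter.a (pos k)) := by positivity
      simp only [hkU, if_false]
      split_ifs <;> linarith

/-- The states of a run on a placement word give a perfect matching of the brackets in which
matched brackets share a cycle at a state of the run. -/
theorem IsPlacement.exists_matching [Fintype Q] (h : IsPlacement σ pos)
    (hA : ∀ w ∈ A.accepts, IsUWord w) {hn : 0 < n}
    (hw : (fun a => w.count a) = placementVector hn pos M) (hM : Fintype.card Q ≤ M)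
    {s f : Q} {S : Set Q} (hrun : RunIn A S s w f)
    (hS : ∀ q ∈ S, ∃ u v, FromStart A u q ∧ ToAccept A q v) :
    ∃ φ : {k // σ.toList.get k = DyckStep.U} → Fin σ.toList.length, Function.Injective φ ∧
      ∀ k, σ.toList.get (φ k) = DyckStep.D ∧ k.1 < φ k ∧
        ∃ q ∈ S, OnCycle A q (pos k.1) (pos (φ k)) := by
  classical
  let t : {k // σ.toList.get k = DyckStep.U} → Finset (Fin σ.toList.length) := fun k =>
    Finset.univ.filter fun l => σ.toList.get l = DyckStep.D ∧ k.1 < l ∧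
      ∃ q ∈ S, OnCycle A q (pos k.1) (pos l)
  obtain ⟨φ, hφ, hφt⟩ := (Finset.all_card_le_biUnion_card_iff_exists_injective t).1 (by
    intro B
    set U : Finset (Fin σ.toList.length) := B.map (Function.Embedding.subtype _) with hUdef
    set V := B.biUnion t with hVdef
    have hUmem : ∀ k ∈ U, ∃ hk, (⟨k, hk⟩ : {k // σ.toList.get k = DyckStep.U}) ∈ B := by
      intro k hk
      simpa [hUdef] using hk
    have hcard : B.card = U.card := (Finset.card_map _).symm
    rw [hcard]
    -- Hall's condition is read off from the weight of `w`: it equals `M * (|U| - |V|)`, yet it is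
    -- less than the number of states in `S`, hence less than `M`. So `|U| ≤ |V|`.
    let e : Fin σ.toList.length → ℤ := fun k => (if k ∈ U then 1 else 0) - (if k ∈ V then 1 else 0)
    let g : OCLetter n → ℤ := fun x => ∑ k, if x = OCLetter.a (pos k) then e k else 0
    have he : ∀ k, e k ≤ 1 := fun k => by
      simp only [e]
      split_ifs <;> norm_num
    have hg : ∀ x, g x ≤ 1 := by
      intro x
      by_cases hx : ∃ k, x = OCLetter.a (pos k)
      · obtain ⟨k, rfl⟩ := hx
        simp only [g, OCLetter.a.injEq, h.strictMono.injective.eq_iff]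
        simpa using he k
      · push Not at hx
        simp [g, hx]
    have hsum : ∀ y : List (OCLetter n), (y.map g).sum =
        ∑ k, e k * y.count (OCLetter.a (pos k)) := sum_map_letter_weight _ e
    have hlt := RunIn.weight_lt_ncard g hg {a | a ∈ w} S.ncard S rfl (by
      intro q hq y hy hyw
      obtain ⟨u, v, hu, hv⟩ := hS q hq
      rw [hsum]
      refine h.cycle_weight_nonpos hA hu hv (hy.mono (Set.subset_univ _))
        (fun j hj => exists_of_a_mem_placement hw (hyw _ hj)) U V
        (fun k hk => (hUmem k hk).1) ?_ ?_
      · intro k hk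
        obtain ⟨k', _, hk'⟩ := Finset.mem_biUnion.1 hk
        exact (Finset.mem_filter.1 hk').2.1
      · intro k hk l hkl hl hc
        obtain ⟨hkU, hkB⟩ := hUmem k hk
        exact Finset.mem_biUnion.2 ⟨_, hkB,
          Finset.mem_filter.2 ⟨Finset.mem_univ _, hl, hkl, q, hq, hc⟩⟩) s w f hrun (fun a ha => ha)
    rw [hsum] at hlt
    simp only [count_a_placement h hw] at hlt
    rw [← Finset.sum_mul, Finset.sum_sub_distrib] at hlt
    simp only [Finset.sum_ite_mem, Finset.univ_inter, Finset.sum_const, nsmul_eq_mul,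
      mul_one] at hlt
    have hSM : (S.ncard : ℤ) ≤ M := by
      have : S.ncard ≤ Nat.card Q := Set.ncard_le_card S
      rw [Nat.card_eq_fintype_card] at this
      exact_mod_cast this.trans hM
    by_contra! hcon
    have h1 : (1 : ℤ) ≤ (U.card : ℤ) - V.card := by omega
    nlinarith)
  refine ⟨φ, hφ, fun k => ?_⟩
  exact (Finset.mem_filter.1 (hφt k)).2

/-- A matching of all opening brackets with closing brackets, together with a time for each pair,
gives a re-pairing that erases the pairs in the order of their times. -/
theorem exists_rePairing (φ : {k // σ.toList.get k = DyckStep.U} → Fin σ.toList.length)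
    (hφ : Function.Injective φ)
    (hD : ∀ k, σ.toList.get (φ k) = DyckStep.D) (hlt : ∀ k, k.1 < φ k)
    (τ : {k // σ.toList.get k = DyckStep.U} → ℕ) :
    ∃ (p : RePairing σ) (e : Fin σ.semilength → {k // σ.toList.get k = DyckStep.U}),
      Monotone (τ ∘ e) ∧ (∀ i, p.left i = (e i).1) ∧ ∀ i, p.right i = φ (e i) := by
  classical
  have hcard : Fintype.card {k // σ.toList.get k = DyckStep.U} = σ.semilength := card_get_eq _ _
  let e₀ := (Fintype.equivFinOfCardEq hcard).symm
  let e := (Tuple.sort (τ ∘ e₀)).trans e₀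
  let ψ : {k // σ.toList.get k = DyckStep.U} → {k // σ.toList.get k = DyckStep.D} :=
    fun k => ⟨φ k, hD k⟩
  have hψ : Function.Bijective ψ := by
    refine (Fintype.bijective_iff_injective_and_card ψ).2 ⟨fun a b hab => ?_, ?_⟩
    · exact hφ (congrArg Subtype.val hab)
    · rw [card_get_eq, card_get_eq, σ.count_U_eq_count_D]
  refine ⟨⟨fun i => (e i).1, fun i => φ (e i), fun i => (e i).2, fun i => hD _,
    fun i => hlt _, fun b => ?_⟩, e, Tuple.monotone_sort (τ ∘ e₀), fun _ => rfl, fun _ => rfl⟩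
  rcases DyckStep.dichotomy (σ.toList.get b) with hb | hb
  · refine ⟨e.symm ⟨b, hb⟩, by simp, ?_⟩
    rintro i (hi | hi)
    · rw [Equiv.eq_symm_apply]
      exact Subtype.ext hi
    · have := hD (e i)
      rw [hi, hb] at this
      cases this
  · obtain ⟨k, hk⟩ := hψ.2 ⟨b, hb⟩
    have hkb : φ k = b := congrArg Subtype.val hk
    refine ⟨e.symm k, by simp [hkb], ?_⟩
    rintro i (hi | hi)
    · have := (e i).2
      rw [hi, hb] at this
      cases this
    · rw [Equiv.eq_symm_apply]
      exact hφ (hi.trans hkb.symm)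

/-- If every state visited on the word of a placement forces at most `s` vertices, then the width
of the Dyck word is at most `2 * s + 1`. -/
theorem IsPlacement.width_le [Fintype Q] (h : IsPlacement σ pos)
    (hA : ∀ w ∈ A.accepts, IsUWord w) {hn : 0 < n} (hn2 : 2 ≤ n)
    (hw : (fun a => w.count a) = placementVector hn pos M) (hM : Fintype.card Q ≤ M)
    (hwA : w ∈ A.accepts) {s : ℕ}
    (hs : ∀ u v q, u ++ v = w → FromStart A u q → ToAccept A q v → (forced A q).ncard ≤ s) :
    σ.width ≤ 2 * s + 1 := by
  classical
  obtain ⟨q₀, hq₀, f, hf, hrun⟩ := mem_accepts_iff_runIn.1 hwA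
  obtain ⟨st, hst0, hst1, hst⟩ := hrun.exists_states
  have hmid : ∀ i j, i ≤ j → j ≤ w.length →
      RunIn A Set.univ (st i) ((w.take j).drop i) (st j) := hst Set.univ fun _ _ => trivial
  have hfrom : ∀ i ≤ w.length, FromStart A (w.take i) (st i) := fun i hi =>
    ⟨q₀, hq₀, by simpa [hst0] using hmid 0 i (by simp) hi⟩
  have hto : ∀ i ≤ w.length, ToAccept A (st i) (w.drop i) := fun i hi =>
    ⟨f, hf, by simpa [hst1] using hmid i w.length hi le_rfl⟩
  let S : Set Q := {q | ∃ i ≤ w.length, st i = q}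
  have hrunS : RunIn A S (st 0) w (st w.length) := by
    simpa using hst S (fun i hi => ⟨i, hi, rfl⟩) 0 w.length (by simp) le_rfl
  obtain ⟨φ, hφ, hφ'⟩ := h.exists_matching hA hw hM hrunS (by
    rintro q ⟨i, hi, rfl⟩
    exact ⟨_, _, hfrom i hi, hto i hi⟩)
  choose hD hlt r hr hcyc using hφ'
  choose τ hτ hτr using hr
  obtain ⟨p, e, hmono, hleft, hright⟩ := exists_rePairing φ hφ hD hlt τ
  refine DyckWord.width_le_of_rePairing p fun t ht => ?_
  rcases t with _ | j
  · refine (setWidth_le_card_starts (p.erased_lt 0) ∅ ?_).trans (by simp)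
    rintro x ⟨i, hi, _⟩
    omega
  let j' : Fin σ.semilength := ⟨j, ht⟩
  -- The comparison time is that of the last erased pair `j'`; the case of no erased pair was split
  -- off because it has no such time.
  set T := τ (e j') with hT
  have hTw : T ≤ w.length := hτ _
  set F := forced A (st T) with hF
  have hFs : F.ncard ≤ s := hs _ _ _ (List.take_append_drop T w) (hfrom T hTw) (hto T hTw)
  let K : Finset (Fin σ.toList.length) := Finset.univ.filter fun k => pos k ∈ F
  have hK : K.card ≤ s := by
    refine le_trans ?_ hFs
    rw [← Set.ncard_coe_finset]
    exact Set.ncard_le_ncard_of_injOn pos (fun k hk => by simpa [K] using hk)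
      h.strictMono.injective.injOn (Set.toFinite _)
  -- the brackets of the pair `i` lie on a cycle at the state of time `τ (e i)`
  have hpair : ∀ (i : Fin σ.semilength) (k : Fin σ.toList.length),
      (p.left i = k ∨ p.right i = k) → ∃ y, RunIn A Set.univ (st (τ (e i))) y (st (τ (e i))) ∧
        OCLetter.a (pos k) ∈ y := by
    intro i k hk
    obtain ⟨y, hy, h1, h2⟩ := hcyc (e i)
    rw [hτr]
    rcases hk with rfl | rfl
    · exact ⟨y, hy, by rw [hleft]; exact h1⟩
    · exact ⟨y, hy, by rw [hright]; exact h2⟩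
  have hbefore : ∀ i ≤ j', ∀ k, (p.left i = k ∨ p.right i = k) → pos k ∉ F →
      HasOut (w.take T) (pos k) := by
    intro i hi k hk hkF
    obtain ⟨y, hy, hky⟩ := hpair i k hk
    have hle : τ (e i) ≤ T := hmono hi
    rcases hle.eq_or_lt with heq | hlt
    -- Pairs whose time equals `T` cause no ambiguity: their brackets lie on a cycle at the state
    -- itself and are therefore forced.
    · rw [heq] at hy
      exact absurd (mem_forced_of_mem_cycle hy hky hA (h.pos_pos k) (h.succ_lt k)) hkF
    · have := hasOut_of_cycle_left hkF hy hky hA (h.pos_pos k) (h.succ_lt k)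
        (hfrom _ (hτ _)) (hmid _ _ hle hTw) (hto T hTw)
      have htt : w.take (τ (e i)) = (w.take T).take (τ (e i)) := by
        rw [List.take_take, min_eq_left hle]
      rwa [htt, List.take_append_drop] at this
  have hafter : ∀ i, j' < i → ∀ k, (p.left i = k ∨ p.right i = k) → pos k ∉ F →
      ¬ HasOut (w.take T) (pos k) := by
    intro i hi k hk hkF
    obtain ⟨y, hy, hky⟩ := hpair i k hk
    have hle : T ≤ τ (e i) := hmono hi.le
    rcases hle.eq_or_lt with heq | hlt
    · rw [← heq] at hy
      exact absurd (mem_forced_of_mem_cycle hy hky hA (h.pos_pos k) (h.succ_lt k)) hkF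
    · exact not_hasOut_of_cycle_right hkF hy hky hA (h.pos_pos k) (h.succ_lt k)
        (hfrom T hTw) (hmid _ _ hle (hτ _)) (hto _ (hτ _))
  -- An interval of erased positions can start only at `0`, at a forced bracket, or right after one.
  let E : Finset ℕ := {0} ∪ (K.image fun k : Fin _ => (k : ℕ)) ∪
    (K.image fun k : Fin _ => (k : ℕ) + 1)
  have hE : E.card ≤ 2 * s + 1 := by
    have h1 : E.card ≤ 1 + K.card + K.card :=
      (Finset.card_union_le _ _).trans (add_le_add
        ((Finset.card_union_le _ _).trans (add_le_add (by simp) Finset.card_image_le))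
        Finset.card_image_le)
    omega
  refine (setWidth_le_card_starts (p.erased_lt (j + 1)) E fun x hx hx0 => ?_).trans hE
  have hxN := p.erased_lt _ x hx
  by_contra hxE
  have hxne : x ≠ 0 := fun h0 => hxE (by simp [E, h0])
  obtain ⟨m, rfl⟩ := Nat.exists_eq_succ_of_ne_zero hxne
  have hx1 : pos ⟨m + 1, hxN⟩ ∉ F := fun hmem => hxE (by
    simp only [E, Finset.mem_union, Finset.mem_image]
    exact .inl (.inr ⟨⟨m + 1, hxN⟩, by simpa [K] using hmem, rfl⟩))
  have hmN : m < σ.toList.length := by omega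
  have hx2 : pos ⟨m, hmN⟩ ∉ F := fun hmem => hxE (by
    simp only [E, Finset.mem_union, Finset.mem_image]
    exact .inr ⟨⟨m, hmN⟩, by simpa [K] using hmem, rfl⟩)
  have hout1 : HasOut (w.take T) (pos ⟨m + 1, hxN⟩) := by
    obtain ⟨i, hi, hi'⟩ := hx
    refine hbefore i (Fin.le_def.2 (Nat.lt_succ_iff.1 hi)) _ ?_ hx1
    rcases hi' with hi' | hi'
    · exact .inl (Fin.ext hi'.symm)
    · exact .inr (Fin.ext hi'.symm)
  have hout2 : ¬ HasOut (w.take T) (pos ⟨m, hmN⟩) := by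
    obtain ⟨i, hi, -⟩ := p.existsUnique_pair ⟨m, hmN⟩
    refine hafter i ?_ _ hi hx2
    by_contra! hle
    refine (hx0.resolve_left (by simp)) ⟨i, Nat.lt_succ_iff.2 hle, ?_⟩
    rcases hi with hi | hi
    · exact .inl (by simp [hi])
    · exact .inr (by simp [hi])
  -- The edge from bracket `m` to `m + 1` is unread at time `T`, while the edge leaving `m + 1` has
  -- been read: this forces `m + 1`.
  rw [hasOut_iff_hasIn_succ h hn2 hw (List.take_subset T w) m hxN] at hout2
  exact hx1 (mem_forced_of_hasIn_ne_hasOut (by tauto) hA (h.pos_pos _) (h.succ_lt _)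
    (hfrom T hTw) (hto T hTw))

end RePair

/-! ### Counting placements -/

section Counting

variable {n b : ℕ} {σ : DyckWord}

/-- The placement that puts the bracket `k` at the `e k`-th vertex of the right parity in the `k`-th
of consecutive blocks of `2 * b` vertices. -/
def blockPlacement (hb : 2 * (σ.toList.length * b) + 2 < n) (e : Fin σ.toList.length → Fin b)
    (k : Fin σ.toList.length) : Fin n :=
  -- The even offset `2` avoids vertex `0` and leaves the parity to the last summand.
  ⟨2 + 2 * (k * b + e k) + if σ.toList.get k = DyckStep.U then 0 else 1, by
    have h1 : ((k : ℕ) + 1) * b ≤ σ.toList.length * b := Nat.mul_le_mul_right b k.2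
    have h2 := (e k).2
    rw [add_mul, one_mul] at h1
    split_ifs <;> omega⟩

theorem isPlacement_blockPlacement (hb : 2 * (σ.toList.length * b) + 2 < n)
    (e : Fin σ.toList.length → Fin b) : IsPlacement σ (blockPlacement hb e) where
  strictMono k l hkl := by
    have h1 : ((k : ℕ) + 1) * b ≤ l * b := Nat.mul_le_mul_right b hkl
    have h2 := (e k).2
    rw [add_mul, one_mul] at h1
    rw [Fin.lt_def]
    simp only [blockPlacement]
    split_ifs <;> omega
  pos_pos k := by simp only [blockPlacement]; omega
  succ_lt k := by
    have h1 : ((k : ℕ) + 1) * b ≤ σ.toList.length * b := Nat.mul_le_mul_right b k.2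
    have h2 := (e k).2
    rw [add_mul, one_mul] at h1
    simp only [blockPlacement]
    split_ifs <;> omega
  even_of_U k hk := by
    simp only [blockPlacement, hk, if_true]
    exact ⟨1 + (k * b + e k), by ring⟩
  odd_of_D k hk := by
    simp only [blockPlacement, hk, reduceCtorEq, if_false]
    exact ⟨1 + (k * b + e k), by ring⟩

theorem blockPlacement_eq (hb : 2 * (σ.toList.length * b) + 2 < n)
    {e e' : Fin σ.toList.length → Fin b} {k k' : Fin σ.toList.length}
    (h : blockPlacement hb e k = blockPlacement hb e' k') : k = k' ∧ e k = e' k' := by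
  have h1 : (k : ℕ) * b + e k = k' * b + e' k' := by
    have := congrArg Fin.val h
    simp only [blockPlacement] at this
    split_ifs at this <;> omega
  have hb0 : 0 < b := (Nat.zero_le _).trans_lt (e k).2
  have hk : (k : ℕ) = k' := by
    have h2 := congrArg (· / b) h1
    simpa [add_comm, mul_comm, Nat.add_mul_div_left _ _ hb0, Nat.div_eq_of_lt] using h2
  refine ⟨Fin.ext hk, Fin.ext ?_⟩
  rw [hk] at h1
  omega

/-- A vertex determines its block and the choice made there, so all placements through `F` agree on
`F.ncard` coordinates and are free only on the others. -/
theorem card_blockPlacement_le (hb : 2 * (σ.toList.length * b) + 2 < n) (F : Set (Fin n))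
    (X : Finset (Fin σ.toList.length → Fin b))
    (hX : ∀ e ∈ X, F ⊆ Set.range (blockPlacement hb e)) :
    X.card ≤ b ^ (σ.toList.length - F.ncard) := by
  classical
  rcases X.eq_empty_or_nonempty with rfl | ⟨e₀, he₀⟩
  · simp
  let J : Finset (Fin σ.toList.length) := Finset.univ.filter fun k => blockPlacement hb e₀ k ∈ F
  have hJ : J.card = F.ncard := by
    have hF : F = blockPlacement hb e₀ '' (J : Set (Fin σ.toList.length)) := by
      ext x
      constructor
      · intro hx
        obtain ⟨k, rfl⟩ := hX e₀ he₀ hx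
        exact ⟨k, by simpa [J] using hx, rfl⟩
      · rintro ⟨k, hk, rfl⟩
        simpa [J] using hk
    rw [hF, Set.ncard_image_of_injective _
      (isPlacement_blockPlacement hb e₀).strictMono.injective, Set.ncard_coe_finset]
  have hsub : X ⊆ Fintype.piFinset fun k => if k ∈ J then {e₀ k} else Finset.univ := by
    intro e he
    rw [Fintype.mem_piFinset]
    intro k
    split_ifs with hk
    · obtain ⟨k', hk'⟩ := hX e he (Finset.mem_filter.1 hk).2
      obtain ⟨rfl, h⟩ := blockPlacement_eq hb hk'
      exact Finset.mem_singleton.2 h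
    · exact Finset.mem_univ _
  refine (Finset.card_le_card hsub).trans (le_of_eq ?_)
  have hcard : ∀ k, (if k ∈ J then ({e₀ k} : Finset (Fin b)) else Finset.univ).card =
      if k ∈ J then 1 else b := by
    intro k
    split_ifs <;> simp
  have hJc : (Finset.univ.filter fun k => k ∉ J).card = σ.toList.length - F.ncard := by
    have hJ' := Finset.card_compl J
    rw [hJ, Fintype.card_fin] at hJ'
    rw [← hJ']
    congr 1
    ext k
    simp
  simp only [Fintype.card_piFinset, hcard, Finset.prod_ite, Finset.prod_const_one, one_mul,
    Finset.prod_const, hJc]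

variable {Q : Type*} {A : NFA (OCLetter n) Q}

theorem isUWord_of_mem_accepts (hP : parikhImage A.accepts = universalOneCounterSet n)
    {w : List (OCLetter n)} (hw : w ∈ A.accepts) : IsUWord w := by
  rw [IsUWord, ← hP]
  exact ⟨w, hw, rfl⟩

theorem exists_word_of_mem (hP : parikhImage A.accepts = universalOneCounterSet n)
    {x : OCLetter n → ℕ} (hx : x ∈ universalOneCounterSet n) :
    ∃ w ∈ A.accepts, (fun a => w.count a) = x := by
  rw [← hP] at hx
  obtain ⟨w, hw, rfl⟩ := hx
  exact ⟨w, hw, rfl⟩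

/-- Assign to each of the `b ^ N` placements, `N` the length of `σ`, a state forcing at least `s` of
its vertices. Each state is assigned at most `b ^ (N - s)` times. -/
theorem pow_le_card_states [Fintype Q] (hP : parikhImage A.accepts = universalOneCounterSet n)
    (hb : 2 * (σ.toList.length * b) + 2 < n) (hb0 : 0 < b) (s : ℕ) (hs : 2 * s ≤ σ.width) :
    b ^ s ≤ Fintype.card Q := by
  classical
  have hn : 0 < n := by omega
  have hn2 : 2 ≤ n := by omega
  have hA : ∀ w ∈ A.accepts, IsUWord w := fun w hw => isUWord_of_mem_accepts hP hw
  choose w hwA hw using fun e : Fin σ.toList.length → Fin b => exists_word_of_mem hP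
    (placementVector_mem (isPlacement_blockPlacement hb e) hn hn2 (Fintype.card Q))
  rcases Nat.eq_zero_or_pos s with rfl | hs0
  · obtain ⟨q, _⟩ := mem_accepts_iff_runIn.1 (hwA fun _ => ⟨0, hb0⟩)
    have : Nonempty Q := ⟨q⟩
    simpa using Nat.one_le_iff_ne_zero.2 Fintype.card_ne_zero
  have key : ∀ e, ∃ q, s ≤ (forced A q).ncard ∧ forced A q ⊆ Set.range (blockPlacement hb e) := by
    intro e
    by_contra! hcon
    -- If all states forced at most `s - 1` vertices, the width would be at most `2 * s - 1`; the
    -- case `s = 0` was separated because of truncated subtraction.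
    have := (isPlacement_blockPlacement hb e).width_le hA hn2 (hw e) le_rfl (hwA e) (s := s - 1)
      (fun u v q huv hu hv => by
        by_contra! hlt
        exact hcon q (by omega) (forced_subset_range (huv ▸ hw e) hu hv))
    omega
  choose q hqs hq using key
  have hsN : s ≤ σ.toList.length := by
    have := σ.width_le_length
    omega
  have h1 := Finset.card_le_mul_card_image (f := q) Finset.univ (b ^ (σ.toList.length - s)) (by
    intro r hr
    obtain ⟨e₀, -, rfl⟩ := Finset.mem_image.1 hr
    refine (card_blockPlacement_le hb (forced A (q e₀)) _ fun e he => ?_).trans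
      (Nat.pow_le_pow_right hb0 (Nat.sub_le_sub_left (hqs e₀) _))
    rw [← (Finset.mem_filter.1 he).2]
    exact hq e)
  have h2 : (Finset.univ.image q).card ≤ Fintype.card Q := Finset.card_le_univ _
  have hpow : b ^ σ.toList.length = b ^ (σ.toList.length - s) * b ^ s := by
    rw [← pow_add, Nat.sub_add_cancel hsN]
  rw [Finset.card_univ, Fintype.card_fun, Fintype.card_fin, Fintype.card_fin, hpow] at h1
  exact (Nat.le_of_mul_le_mul_left h1 (by positivity)).trans h2

/-- The word of the full path shows that there are at least `n` states. -/
theorem le_card_states [Fintype Q]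
    (hP : parikhImage A.accepts = universalOneCounterSet n) (hn : 2 ≤ n) :
    n ≤ Fintype.card Q := by
  have hA : ∀ w ∈ A.accepts, IsUWord w := fun w hw => isUWord_of_mem_accepts hP hw
  have hx : pathVector (List.finRange n) (fun _ => 0) ∈ universalOneCounterSet n := by
    refine pathVector_mem ?_ ⟨⟨0, by omega⟩, ?_, rfl⟩ ⟨⟨n - 1, by omega⟩, ?_, by simp; omega⟩
      ⟨by simp, by simp⟩ (by simp)
    · rw [List.isChain_iff_getElem]
      intro i hi
      simp [Fin.lt_def]
    · rw [List.head?_eq_getElem?, List.getElem?_eq_getElem (by simp; omega)]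
      simp
    · rw [List.getLast?_eq_getElem?, List.getElem?_eq_getElem (by simp; omega)]
      simp
  obtain ⟨w, hwA, hw⟩ := exists_word_of_mem hP hx
  let f : Fin (n - 1) → OCLetter n := fun m =>
    OCLetter.c ⟨m, by omega⟩ ⟨m + 1, by omega⟩ (by simp [Fin.lt_def])
  have hf : Function.Injective f := by
    intro m m' h
    simp only [f, OCLetter.c.injEq, Fin.mk.injEq] at h
    exact Fin.ext h.1
  let g : OCLetter n → ℤ := fun x => ∑ m, if x = f m then 1 else 0
  have hg : ∀ x, g x ≤ 1 := by
    intro x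
    by_cases hx : ∃ m, x = f m
    · obtain ⟨m, rfl⟩ := hx
      refine le_of_eq ?_
      simp only [g, hf.eq_iff, Finset.sum_ite_eq, Finset.mem_univ, if_true]
    · push Not at hx
      simp [g, hx]
  have hsum : ∀ y : List (OCLetter n), (y.map g).sum = ∑ m, (y.count (f m) : ℤ) := fun y => by
    rw [sum_map_letter_weight f (fun _ => 1) y]
    simp
  obtain ⟨q₀, hq₀, t, ht, hrun⟩ := mem_accepts_iff_runIn.1 hwA
  obtain ⟨st, hst0, hst1, hst⟩ := hrun.exists_states
  have hmid := hst Set.univ fun _ _ => trivial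
  let S : Set Q := {q | ∃ i ≤ w.length, st i = q}
  have hrunS : RunIn A S (st 0) w (st w.length) := by
    simpa using hst S (fun i hi => ⟨i, hi, rfl⟩) 0 w.length (by simp) le_rfl
  -- The weight counts the `n - 1` edge letters of the full path. Cycles contain none, so the run
  -- visits more than `n - 1` states.
  have hlt := RunIn.weight_lt_ncard g hg Set.univ S.ncard S rfl (by
    rintro q ⟨i, hi, rfl⟩ y hy -
    rw [hsum]
    refine Finset.sum_nonpos fun m _ => ?_
    have hu : FromStart A (w.take i) (st i) :=
      ⟨q₀, hq₀, by simpa [hst0] using hmid 0 i (by simp) hi⟩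
    have hv : ToAccept A (st i) (w.drop i) :=
      ⟨t, ht, by simpa [hst1] using hmid i w.length hi le_rfl⟩
    have : f m ∉ y := (hy.mono (Set.subset_univ _)).c_notMem hA hu hv _ _ _
    simp [List.count_eq_zero.2 this]) _ _ _ hrunS (fun _ _ => trivial)
  have hone : ∀ m, w.count (f m) = 1 := by
    intro m
    refine (congrFun hw (f m)).trans ?_
    simp only [f, pathVector]
    rw [if_pos]
    rw [mem_zip_tail_iff]
    exact ⟨m, by simp; omega, by simp, by simp⟩
  rw [hsum] at hlt
  simp only [hone, Nat.cast_one, Finset.sum_const, Finset.card_univ, Fintype.card_fin,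
    nsmul_eq_mul, mul_one] at hlt
  have : S.ncard ≤ Nat.card Q := Set.ncard_le_card S
  rw [Nat.card_eq_fintype_card] at this
  omega

end Counting

theorem mainTheorem1 :
    ∀ C : ℝ, 0 < C → ∃ c : ℝ, 0 < c ∧
      ∀ n : ℕ, 2 ≤ n → Even n →
        ∀ σ : DyckWord, (σ.toList.length : ℝ) ≤ C * Real.sqrt n →
          ∀ (Q : Type*) [Fintype Q] (A : NFA (OCLetter n) Q),
            parikhImage A.accepts = universalOneCounterSet n →
              (n : ℝ) ^ (c * (σ.width : ℝ)) ≤ (Fintype.card Q : ℝ) := by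
  intro C hC
  set D : ℝ := C * (4 * C + 2) ^ 2 + 1 with hD
  have hD1 : 1 ≤ D := by
    have : 0 ≤ C * (4 * C + 2) ^ 2 := by positivity
    linarith
  -- `1 / D` handles bounded `n`, where the width is at most `D` and the linear bound `n` suffices.
  -- `1 / 12` is the product of `1 / 4`, from `b ≥ n ^ (1/4)`, and `1 / 3`, from `width ≤ 3 * ⌊width
  -- / 2⌋` for width at least two.
  refine ⟨min (1 / 12) (1 / D), by positivity, fun n hn _ σ hσ Q _ A hP => ?_⟩
  set c : ℝ := min (1 / 12) (1 / D) with hc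
  have hc0 : 0 < c := by positivity
  have hc12 : c ≤ 1 / 12 := min_le_left _ _
  have hcD : c ≤ 1 / D := min_le_right _ _
  have hn1 : (1 : ℝ) ≤ n := by exact_mod_cast (by omega : 1 ≤ n)
  have hcard : (n : ℝ) ≤ Fintype.card Q := by exact_mod_cast le_card_states hP hn
  have hsmall : c * (σ.width : ℝ) ≤ 1 → (n : ℝ) ^ (c * (σ.width : ℝ)) ≤ (Fintype.card Q : ℝ) :=
    fun h => (Real.rpow_le_rpow_of_exponent_le hn1 h).trans (by simpa using hcard)
  set x : ℝ := (n : ℝ) ^ (1 / 4 : ℝ) with hx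
  have hx0 : 0 ≤ x := by positivity
  have hx4 : x ^ 4 = n := by
    rw [hx, ← Real.rpow_natCast, ← Real.rpow_mul (by positivity)]
    norm_num
  have hx2 : Real.sqrt n = x ^ 2 := by
    rw [← hx4, show x ^ 4 = (x ^ 2) ^ 2 by ring, Real.sqrt_sq (by positivity)]
  rw [hx2] at hσ
  rcases le_or_gt x (4 * C + 2) with hle | hgt
  · apply hsmall
    have hwD : (σ.width : ℝ) ≤ D := by
      have h1 : (σ.width : ℝ) ≤ σ.toList.length := by exact_mod_cast σ.width_le_length
      have h2 : C * x ^ 2 ≤ C * (4 * C + 2) ^ 2 := by gcongr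
      linarith
    calc c * (σ.width : ℝ) ≤ 1 / D * D := by gcongr
      _ = 1 := by field_simp
  rcases Nat.lt_or_ge σ.width 2 with hw | hw
  · apply hsmall
    have : (σ.width : ℝ) ≤ 1 := by exact_mod_cast (by omega : σ.width ≤ 1)
    nlinarith
  -- The blocks take at most `2 * C * x ^ 2 * (x + 1) ≤ 4 * C * x ^ 3` vertices, and `x > 4 * C + 2`
  -- makes this plus `2` smaller than `x ^ 4 = n`.
  have hb : 2 * (σ.toList.length * ⌈x⌉₊) + 2 < n := by
    have h1 : (⌈x⌉₊ : ℝ) ≤ x + 1 := (Nat.ceil_lt_add_one hx0).le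
    have h2 : (σ.toList.length : ℝ) * ⌈x⌉₊ ≤ C * x ^ 2 * (x + 1) := by gcongr
    have hx1 : 1 < x := by linarith
    have h3 : C * x ^ 2 * (x + 1) ≤ C * x ^ 2 * (2 * x) := by gcongr; linarith
    have h4 : (4 * C + 2) * x ^ 3 < x * x ^ 3 := by gcongr
    have h5 : 1 < x ^ 3 := one_lt_pow₀ hx1 (by norm_num)
    have h6 : 2 * ((σ.toList.length : ℝ) * ⌈x⌉₊) + 2 < n := by
      rw [← hx4]
      nlinarith
    exact_mod_cast h6
  have hb0 : 0 < ⌈x⌉₊ := Nat.ceil_pos.2 (by linarith)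
  have hpow := pow_le_card_states hP hb hb0 (σ.width / 2) (by omega)
  have hexp : c * (σ.width : ℝ) ≤ 1 / 4 * ((σ.width / 2 : ℕ) : ℝ) := by
    have h1 : (σ.width : ℝ) ≤ 3 * ((σ.width / 2 : ℕ) : ℝ) := by
      exact_mod_cast (by omega : σ.width ≤ 3 * (σ.width / 2))
    have h2 : c * (σ.width : ℝ) ≤ 1 / 12 * (σ.width : ℝ) := by gcongr
    linarith
  calc (n : ℝ) ^ (c * (σ.width : ℝ)) ≤ (n : ℝ) ^ (1 / 4 * ((σ.width / 2 : ℕ) : ℝ)) :=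
        Real.rpow_le_rpow_of_exponent_le hn1 hexp
    _ = x ^ (σ.width / 2) := by rw [Real.rpow_mul (by positivity), Real.rpow_natCast]
    _ ≤ (⌈x⌉₊ : ℝ) ^ (σ.width / 2) := by gcongr; exact Nat.le_ceil x
    _ ≤ Fintype.card Q := by exact_mod_cast hpow
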